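/- Let $X$ be a completely regular Hausdorff space with its Borel $\sigma$-algebra, and let $\rho\colon X\to(0,\infty)$ be an admissible weight function, i.e. all sublevel sets $\{\rho\le R\}$, $R>0$, are compact. Let $B^\rho(X)$ be the space of all functions $f\colon X\to\mathbb R$ with $\|f\|_\rho:=\sup_{x\in X}\rho(x)^{-1}|f(x)|<\infty$, and let $\mathcal B^\rho(X)$ be the closure of the bounded continuous functions in $(B^\rho(X),\|\cdot\|_\rho)$. Let $(P_t)_{t\ge0}$ be a generalized Feller semigroup on $\mathcal B^\rho(X)$, i.e. a family of bounded linear operators on $\mathcal B^\rho(X)$ such that $P_0=I$; $P_{t+s}=P_tP_s$ for all $s,t\ge0$; $\lim_{t\to0+}P_tf(x)=f(x)$ for all $f\in\mathcal B^\rho(X)$, $x\in X$; there are $C\in\mathbb R$ and $\varepsilon>0$ with $\|P_t\|\le C$ for all $t\in[0,\varepsilon]$; and each $P_t$ is positive ($f\ge0$ implies $P_tf\ge0$). Assume that $P_t1=1$ for all $t\ge0$ and that, for some $M,\omega\in\mathbb R$, $P_t\rho\le M e^{\omega t}\rho$ for all $t\ge0$, where $P_t\rho(x):=\sup\{P_tf(x):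 f\in\mathcal B^\rho(X),\ 0\le f\le\rho\}$. Then there exist a measurable space $(\Omega,\mathcal F)$, a family $(\lambda_t)_{t\ge0}$ of measurable maps $\lambda_t\colon\Omega\to X$ and, for every $x_0\in X$, a probability measure $\mathbb P_{x_0}$ on $(\Omega,\mathcal F)$ such that, for every $x_0\in X$: 1. $\lambda_0=x_0$ holds $\mathbb P_{x_0}$-almost surely; 2. for all $t\ge0$ and $f\in\mathcal B^\rho(X)$, $f(\lambda_t)$ is $\mathbb P_{x_0}$-integrable and $\mathbb E_{x_0}[f(\lambda_t)]=P_tf(x_0)$; 3. $(\lambda_t)$ is Markov with semigroup $(P_t)$: for all $0\le s\le t$ and $f\in\mathcal B^\rho(X)$, $\mathbb E_{x_0}[f(\lambda_t)\mid\sigma(\lambda_u:u\le s)]=P_{t-s}f(\lambda_s)$ $\mathbb P_{x_0}$-almost surely. -/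

import Mathlib

open MeasureTheory Filter Topology
open scoped NNReal ENNReal

universe u

/-- An admissible weight function: a function with values in `(0, ∞)` all of whose sublevel sets
`{ρ ≤ R}`, `R > 0`, are compact. -/
structure AdmissibleWeight (X : Type u) [TopologicalSpace X] where
  toFun : X → ℝ
  pos : ∀ x, 0 < toFun x
  isCompact_sublevel : ∀ R : ℝ, 0 < R → IsCompact {x | toFun x ≤ R}

namespace AdmissibleWeight

variable {X : Type u} [TopologicalSpace X]

instance : CoeFun (AdmissibleWeight X) fun _ => X → ℝ := ⟨AdmissibleWeight.toFun⟩

/-- The functions `f` with `sup_x |f x| / ρ x < ∞`, as a linear subspace of all functions. -/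
def growthSubmodule (ρ : AdmissibleWeight X) : Submodule ℝ (X → ℝ) where
  carrier := {f | BddAbove (Set.range fun x => |f x| / ρ x)}
  zero_mem' := ⟨0, by rintro _ ⟨x, rfl⟩; simp⟩
  add_mem' := by
    rintro f g ⟨a, ha⟩ ⟨b, hb⟩
    refine ⟨a + b, ?_⟩
    rintro _ ⟨x, rfl⟩
    have h1 := ha ⟨x, rfl⟩
    have h2 := hb ⟨x, rfl⟩
    calc |(f + g) x| / ρ x ≤ (|f x| + |g x|) / ρ x :=
          div_le_div_of_nonneg_right (abs_add_le _ _) (ρ.pos x).le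
      _ = |f x| / ρ x + |g x| / ρ x := add_div _ _ _
      _ ≤ a + b := add_le_add h1 h2
  smul_mem' := by
    rintro c f ⟨a, ha⟩
    refine ⟨|c| * a, ?_⟩
    rintro _ ⟨x, rfl⟩
    have h1 := ha ⟨x, rfl⟩
    calc |(c • f) x| / ρ x = |c| * (|f x| / ρ x) := by
          simp [abs_mul, mul_div_assoc]
      _ ≤ |c| * a := mul_le_mul_of_nonneg_left h1 (abs_nonneg c)

/-- The space `B^ρ(X)` of all functions `f : X → ℝ` with `sup_x |f x| / ρ x < ∞`. It is a type of
its own, so that its topology is that of the weighted norm and not that of pointwise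
convergence. -/
def BoundedFun (ρ : AdmissibleWeight X) : Type u := ρ.growthSubmodule

namespace BoundedFun

variable {ρ : AdmissibleWeight X}

instance : AddCommGroup (BoundedFun ρ) := inferInstanceAs (AddCommGroup ρ.growthSubmodule)

instance : Module ℝ (BoundedFun ρ) := inferInstanceAs (Module ℝ ρ.growthSubmodule)

instance : CoeFun (BoundedFun ρ) fun _ => X → ℝ := ⟨fun f => f.1⟩

/-- The weighted norm `‖f‖_ρ = sup_x |f x| / ρ x`. -/
noncomputable instance : Norm (BoundedFun ρ) := ⟨fun f => ⨆ x, |f x| / ρ x⟩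

theorem norm_def (f : BoundedFun ρ) : ‖f‖ = ⨆ x, |f x| / ρ x := rfl

theorem norm_nonneg' (f : BoundedFun ρ) : 0 ≤ ‖f‖ :=
  Real.iSup_nonneg fun x => div_nonneg (abs_nonneg _) (ρ.pos x).le

theorem le_norm (f : BoundedFun ρ) (x : X) : |f x| / ρ x ≤ ‖f‖ :=
  le_ciSup (f := fun x => |f x| / ρ x) f.2 x

theorem norm_core : NormedSpace.Core ℝ (BoundedFun ρ) where
  norm_nonneg := norm_nonneg'
  norm_smul c f := by
    rw [norm_def, norm_def, Real.norm_eq_abs, Real.mul_iSup_of_nonneg (abs_nonneg c)]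
    refine congrArg iSup (funext fun x => ?_)
    change |c * f x| / ρ x = |c| * (|f x| / ρ x)
    rw [abs_mul, mul_div_assoc]
  norm_triangle f g := by
    refine Real.iSup_le (fun x => ?_) (add_nonneg (norm_nonneg' f) (norm_nonneg' g))
    calc |(f + g) x| / ρ x ≤ (|f x| + |g x|) / ρ x :=
          div_le_div_of_nonneg_right (abs_add_le (f x) (g x)) (ρ.pos x).le
      _ = |f x| / ρ x + |g x| / ρ x := add_div _ _ _
      _ ≤ ‖f‖ + ‖g‖ := add_le_add (le_norm f x) (le_norm g x)
  norm_eq_zero_iff f := by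
    constructor
    · intro h
      refine Subtype.ext (funext fun x => ?_)
      have h1 := le_norm f x
      rw [h, div_le_iff₀ (ρ.pos x), zero_mul] at h1
      exact abs_eq_zero.1 (le_antisymm h1 (abs_nonneg _))
    · rintro rfl
      rw [norm_def]
      change (⨆ x, |(0 : ℝ)| / ρ x) = 0
      simp

noncomputable instance : NormedAddCommGroup (BoundedFun ρ) :=
  NormedAddCommGroup.ofCore norm_core

noncomputable instance : NormedSpace ℝ (BoundedFun ρ) := NormedSpace.ofCore norm_core

end BoundedFun

/-- The bounded continuous functions, as a linear subspace of `B^ρ(X)`. -/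
def boundedContinuous (ρ : AdmissibleWeight X) : Submodule ℝ (BoundedFun ρ) where
  carrier := {f | Continuous (fun x => f x) ∧ ∃ C : ℝ, ∀ x, |f x| ≤ C}
  zero_mem' := ⟨continuous_const, 0, fun _ => abs_zero.le⟩
  add_mem' := by
    rintro f g ⟨hf, a, ha⟩ ⟨hg, b, hb⟩
    exact ⟨hf.add hg, a + b, fun x => (abs_add_le (f x) (g x)).trans (add_le_add (ha x) (hb x))⟩
  smul_mem' := by
    rintro c f ⟨hf, a, ha⟩
    exact ⟨hf.const_smul c, |c| * a, fun x =>
      (abs_mul c (f x)).le.trans (mul_le_mul_of_nonneg_left (ha x) (abs_nonneg c))⟩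

/-- The space `𝓑^ρ(X)`: the closure of the bounded continuous functions in `B^ρ(X)`, with the
weighted norm. -/
noncomputable def calB (ρ : AdmissibleWeight X) : Submodule ℝ (BoundedFun ρ) :=
  ρ.boundedContinuous.topologicalClosure

instance (ρ : AdmissibleWeight X) : CoeFun ρ.calB fun _ => X → ℝ := ⟨fun f => f.1.1⟩

/-- An admissible weight function on a Hausdorff space is bounded from below by a positive
constant. -/
theorem exists_pos_le [T2Space X] (ρ : AdmissibleWeight X) : ∃ c : ℝ, 0 < c ∧ ∀ x, c ≤ ρ x := by
  by_contra! h
  have hne : ∀ n : ℕ, {x | ρ x ≤ 1 / ((n : ℝ) + 1)}.Nonempty := fun n =>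
    (h _ Nat.one_div_pos_of_nat).imp fun _ hx => hx.le
  have hc : ∀ n : ℕ, IsCompact {x | ρ x ≤ 1 / ((n : ℝ) + 1)} := fun n =>
    ρ.isCompact_sublevel _ Nat.one_div_pos_of_nat
  obtain ⟨x, hx⟩ := IsCompact.nonempty_iInter_of_sequence_nonempty_isCompact_isClosed
    (fun n : ℕ => {x | ρ x ≤ 1 / ((n : ℝ) + 1)})
    (fun n x hx => le_trans (Set.mem_ofPred.1 hx) (Nat.one_div_le_one_div n.le_succ))
    hne (hc 0) (fun n => (hc n).isClosed)
  obtain ⟨n, hn⟩ := exists_nat_one_div_lt (ρ.pos x)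
  exact absurd (Set.mem_iInter.1 hx n) (not_le.2 hn)

/-- Every bounded continuous function is an element of `𝓑^ρ(X)`. -/
noncomputable def ofBoundedContinuous [T2Space X] (ρ : AdmissibleWeight X) (f : X → ℝ)
    (hf : Continuous f) (hb : ∃ C : ℝ, ∀ x, |f x| ≤ C) : ρ.calB :=
  ⟨⟨f, by
    obtain ⟨c, hc, hρ⟩ := ρ.exists_pos_le
    obtain ⟨C, hC⟩ := hb
    refine ⟨C / c, ?_⟩
    rintro _ ⟨x, rfl⟩
    exact div_le_div₀ ((abs_nonneg _).trans (hC x)) (hC x) hc (hρ x)⟩,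
    Submodule.le_topologicalClosure _ ⟨hf, hb⟩⟩

/-- The constant function `1` as an element of `𝓑^ρ(X)`. -/
noncomputable def one [T2Space X] (ρ : AdmissibleWeight X) : ρ.calB :=
  ρ.ofBoundedContinuous (fun _ => 1) continuous_const ⟨1, fun _ => abs_one.le⟩

/-- The value `(T ρ)(x)` of a positive operator `T` on `𝓑^ρ(X)` at the weight function itself.
In general `ρ` is not an element of `𝓑^ρ(X)`, but it is lower semicontinuous, and `T` is extended
to it by monotone approximation from below: `(T ρ)(x) = sup {(T f)(x) : f ∈ 𝓑^ρ(X), 0 ≤ f ≤ ρ}`.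
Equivalently this is the integral of `ρ` against the Radon measure that represents the functional
`f ↦ (T f)(x)`. -/
noncomputable def applyWeight (ρ : AdmissibleWeight X) (T : ρ.calB →L[ℝ] ρ.calB) (x : X) : ℝ≥0∞ :=
  ⨆ (f : ρ.calB) (_ : ∀ y, 0 ≤ f y ∧ f y ≤ ρ y), ENNReal.ofReal (T f x)

/-- Generalized Feller semigroups on `𝓑^ρ(X)`. -/
structure IsGeneralizedFeller (ρ : AdmissibleWeight X) (P : ℝ≥0 → ρ.calB →L[ℝ] ρ.calB) :
    Prop where
  zero : P 0 = ContinuousLinearMap.id ℝ ρ.calB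
  add : ∀ t s : ℝ≥0, P (t + s) = (P t).comp (P s)
  tendsto : ∀ (f : ρ.calB) (x : X), Tendsto (fun t : ℝ≥0 => P t f x) (𝓝[>] 0) (𝓝 (f x))
  bounded : ∃ C : ℝ, ∃ ε : ℝ≥0, 0 < ε ∧ ∀ t ≤ ε, ‖P t‖ ≤ C
  positive : ∀ (t : ℝ≥0) (f : ρ.calB), (∀ x, 0 ≤ f x) → ∀ x, 0 ≤ P t f x

end AdmissibleWeight

/-- The `σ`-algebra `σ(Y u : u ≤ s)` of the natural filtration of a process `Y` at time `s`. -/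
abbrev naturalSigma {Ω X : Type u} [MeasurableSpace X] (Y : ℝ≥0 → Ω → X) (s : ℝ≥0) :
    MeasurableSpace Ω :=
  ⨆ u : Set.Iic s, MeasurableSpace.comap (Y u) inferInstance

/-!
The process is constructed on the space `Ω` of all paths `ℝ≥0 → βX`, where `βX` is the Stone–Čech
compactification of `X`. With the product topology `Ω` is compact Hausdorff, so that laws on `Ω` are
obtained from positive functionals on `C(Ω, ℝ)` by the Riesz–Markov–Kakutani theorem, and their
regularity replaces any countability assumption on `X`.

The space `X` is the union of the compact sets `{ρ ≤ n}`, hence Borel in `βX`, and there is a Borel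
retraction `r : βX → X`. A regular measure on a compact space whose image in `βX` represents, on
bounded continuous functions, a functional that is continuous for the weighted norm, does not charge
the complement of `X`: a continuous function with values in `[0, 1]` that vanishes on `{ρ ≤ R}` has
norm at most `1 / R` (`AdmissibleWeight.ae_mem_range_stoneCechUnit`). It then represents the
functional on all of `𝓑^ρ(X)` (`AdmissibleWeight.integral_retraction`).

Applied to `f ↦ P t f x`, this gives Markov kernels on the Borel sets of `X`; the mass of an open
set is a supremum of functions that are continuous on each `{ρ ≤ R}`, hence measurable in `x`
(`AdmissibleWeight.exists_kernel`). With these kernels one builds, for each finite set `J` of times,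
a law on paths in `X` that is Markovian at the times in `J`
(`AdmissibleWeight.IsGeneralizedFeller.exists_finite_markov_law`). The limit of these laws along an
ultrafilter finer than `atTop` on the finite sets of times is a positive functional on `C(Ω, ℝ)`,
and the measure representing it is the law of the process `Y t = r ∘ (evaluation at t)`. The Markov
property passes to the limit when tested against continuous functionals of the past; here the
functions `P (t - s) f` are in general not continuous, and are approximated by bounded continuous
ones in the weighted norm (`AdmissibleWeight.IsGeneralizedFeller.exists_law`).

Continuous functionals of the past are then replaced by indicators of cylinder sets with Borel
bases, one coordinate at a time, because continuous functions are dense in `L¹` of the law of each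
coordinate; the π-λ theorem yields all events of the natural filtration
(`AdmissibleWeight.setIntegral_eq_zero_of_naturalSigma`).
-/

/-! ### Positive functionals and regular measures on compact spaces -/

/-- The Riesz–Markov–Kakutani theorem on a compact Hausdorff space, for positive linear functionals
on `C(Z, ℝ)`. -/
theorem exists_regular_measure_of_nonneg {Z : Type*} [TopologicalSpace Z] [CompactSpace Z]
    [T2Space Z] [MeasurableSpace Z] [BorelSpace Z] (Λ : C(Z, ℝ) →ₗ[ℝ] ℝ)
    (hΛ : ∀ f : C(Z, ℝ), (∀ z, 0 ≤ f z) → 0 ≤ Λ f) :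
    ∃ m : Measure Z, m.Regular ∧ IsFiniteMeasure m ∧ ∀ f : C(Z, ℝ), ∫ z, f z ∂m = Λ f := by
  let Λ' : CompactlySupportedContinuousMap Z ℝ →ₚ[ℝ] ℝ :=
  { toFun g := Λ g.toContinuousMap
    map_add' g g' := Λ.map_add g.toContinuousMap g'.toContinuousMap
    map_smul' c g := Λ.map_smul c g.toContinuousMap
    monotone' g g' hgg' := by
      have h := hΛ (g'.toContinuousMap - g.toContinuousMap) fun z => sub_nonneg.2 (hgg' z)
      rw [map_sub] at h
      exact sub_nonneg.1 h }
  refine ⟨RealRMK.rieszMeasure Λ', inferInstance, inferInstance, fun f => ?_⟩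
  exact RealRMK.integral_rieszMeasure Λ'
    { toContinuousMap := f, hasCompactSupport' := HasCompactSupport.of_compactSpace _ }

/-- The measure that a regular measure, pushed forward along a continuous map to a compact
Hausdorff space, gives to an open set is determined by the continuous functions below the indicator
of that set. -/
theorem measure_preimage_le_of_integral_le {Z E : Type*} [TopologicalSpace Z] [CompactSpace Z]
    [T2Space Z] [MeasurableSpace Z] [BorelSpace Z] [TopologicalSpace E] [CompactSpace E]
    [T2Space E] (m : Measure Z) [IsFiniteMeasure m] [m.Regular] {φ : Z → E} (hφ : Continuous φ)
    {V : Set E} (hV : IsOpen V) {C : ℝ≥0∞}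
    (hC : ∀ f : C(E, ℝ), (∀ x, f x ∈ Set.Icc (0 : ℝ) 1) → (∀ x ∉ V, f x = 0) →
      ENNReal.ofReal (∫ z, f (φ z) ∂m) ≤ C) : m (φ ⁻¹' V) ≤ C := by
  rw [(hV.preimage hφ).measure_eq_iSup_isCompact]
  refine iSup₂_le fun K hK => iSup_le fun hKc => ?_
  obtain ⟨f, hf0, hf1, hf⟩ := exists_continuous_zero_one_of_isClosed hV.isClosed_compl
    (hKc.image hφ).isClosed (Set.disjoint_compl_left_iff_subset.2 (Set.image_subset_iff.2 hK))
  refine le_trans ?_ (hC f hf fun x hx => hf0 hx)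
  have hint : Integrable (fun z => f (φ z)) m :=
    (f.comp ⟨φ, hφ⟩).continuous.integrable_of_hasCompactSupport
      (HasCompactSupport.of_compactSpace _)
  rw [ofReal_integral_eq_lintegral_ofReal hint (ae_of_all _ fun z => (hf _).1)]
  calc m K ≤ ∫⁻ _ in K, 1 ∂m := by simp
    _ ≤ ∫⁻ z in K, ENNReal.ofReal (f (φ z)) ∂m := by
        refine setLIntegral_mono' hKc.measurableSet fun z hz => ?_
        rw [hf1 ⟨z, hz, rfl⟩]; simp
    _ ≤ _ := setLIntegral_le_lintegral _ _

/-- If a bounded function integrates to zero against every continuous function of `φ`, it does so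
against every indicator function of `φ`: continuous functions are dense in `L¹` of the law
of `φ`. -/
theorem setIntegral_preimage_eq_zero {Z E : Type*} [TopologicalSpace Z] [CompactSpace Z]
    [T2Space Z] [MeasurableSpace Z] [BorelSpace Z] [TopologicalSpace E] [CompactSpace E]
    [T2Space E] [MeasurableSpace E] [BorelSpace E] (m : Measure Z) [IsFiniteMeasure m] [m.Regular]
    {φ : Z → E} (hφ : Continuous φ) {Ψ : Z → ℝ} (hΨ : AEStronglyMeasurable Ψ m) {C : ℝ}
    (hC : ∀ z, |Ψ z| ≤ C) (h0 : ∀ g : C(E, ℝ), ∫ z, g (φ z) * Ψ z ∂m = 0)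
    {B : Set E} (hB : MeasurableSet B) :
    ∫ z, B.indicator (fun _ => (1 : ℝ)) (φ z) * Ψ z ∂m = 0 := by
  have : (m.map φ).InnerRegular := Measure.InnerRegular.map_of_continuous hφ
  have hBi : Integrable (B.indicator fun _ => (1 : ℝ)) (m.map φ) :=
    (integrable_const 1).indicator hB
  have hC0 : 0 ≤ |C| := abs_nonneg C
  refine abs_eq_zero.1 (le_antisymm (le_of_forall_pos_le_add fun ε hε => ?_) (abs_nonneg _))
  obtain ⟨g, hg, hgi⟩ := hBi.exists_boundedContinuous_integral_sub_le
    (show 0 < ε / (|C| + 1) by positivity)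
  have hgm : Integrable (fun z => g (φ z)) m := hgi.comp_measurable hφ.measurable
  have hBm : Integrable (fun z => B.indicator (fun _ => (1 : ℝ)) (φ z)) m :=
    hBi.comp_measurable hφ.measurable
  have hgΨ : Integrable (fun z => g (φ z) * Ψ z) m :=
    hgm.mul_bdd hΨ (ae_of_all _ hC)
  have hBΨ : Integrable (fun z => B.indicator (fun _ => (1 : ℝ)) (φ z) * Ψ z) m :=
    hBm.mul_bdd hΨ (ae_of_all _ hC)
  have hsub : ∫ z, B.indicator (fun _ => (1 : ℝ)) (φ z) * Ψ z ∂m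
      = ∫ z, (B.indicator (fun _ => (1 : ℝ)) (φ z) - g (φ z)) * Ψ z ∂m := by
    have hg0 : ∫ z, g (φ z) * Ψ z ∂m = 0 := h0 g.toContinuousMap
    simp only [sub_mul]
    rw [integral_sub hBΨ hgΨ, hg0, sub_zero]
  have hmap := integral_map hφ.aemeasurable (hBi.sub hgi).norm.aestronglyMeasurable
  simp only [Pi.sub_apply] at hmap
  rw [hmap] at hg
  rw [hsub, zero_add]
  calc ‖∫ z, (B.indicator (fun _ => (1 : ℝ)) (φ z) - g (φ z)) * Ψ z ∂m‖
      ≤ ∫ z, ‖(B.indicator (fun _ => (1 : ℝ)) (φ z) - g (φ z)) * Ψ z‖ ∂m :=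
        norm_integral_le_integral_norm _
    _ ≤ ∫ z, ‖B.indicator (fun _ => (1 : ℝ)) (φ z) - g (φ z)‖ * |C| ∂m := by
        refine integral_mono_of_nonneg (ae_of_all _ fun z => norm_nonneg _)
          ((hBm.sub hgm).norm.mul_const _) (ae_of_all _ fun z => ?_)
        dsimp only
        rw [norm_mul]
        exact mul_le_mul_of_nonneg_left ((hC z).trans (le_abs_self C)) (norm_nonneg _)
    _ ≤ ε / (|C| + 1) * |C| := by
        rw [integral_mul_const]
        exact mul_le_mul_of_nonneg_right hg hC0
    _ ≤ ε := by
        rw [div_mul_eq_mul_div, div_le_iff₀ (by positivity)]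
        nlinarith

namespace AdmissibleWeight

variable {X : Type u} [TopologicalSpace X]

/-! ### The weighted function space -/

theorem abs_apply_le (ρ : AdmissibleWeight X) (f : ρ.calB) (x : X) : |f x| ≤ ‖f‖ * ρ x :=
  (div_le_iff₀ (ρ.pos x)).1 (BoundedFun.le_norm f.1 x)

theorem norm_le_of_abs_le (ρ : AdmissibleWeight X) (f : ρ.calB) {C : ℝ} (hC : 0 ≤ C)
    (h : ∀ x, |f x| ≤ C * ρ x) : ‖f‖ ≤ C :=
  Real.iSup_le (fun x => (div_le_iff₀ (ρ.pos x)).2 (h x)) hC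

/-- Point evaluation as a bounded linear functional on `𝓑^ρ(X)`. -/
noncomputable def evalAt (ρ : AdmissibleWeight X) (x : X) : ρ.calB →L[ℝ] ℝ :=
  LinearMap.mkContinuous
    { toFun := fun f => f x, map_add' := fun _ _ => rfl, map_smul' := fun _ _ => rfl } (ρ x)
    fun f => (ρ.abs_apply_le f x).trans (mul_comm _ _).le

@[simp] theorem evalAt_apply (ρ : AdmissibleWeight X) (x : X) (f : ρ.calB) :
    ρ.evalAt x f = f x := rfl

theorem exists_tendsto_boundedContinuous (ρ : AdmissibleWeight X) (f : ρ.calB) :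
    ∃ g : ℕ → ρ.calB, (∀ n, Continuous (fun x => g n x)) ∧ (∀ n, ∃ C : ℝ, ∀ x, |g n x| ≤ C) ∧
      Tendsto g atTop (𝓝 f) := by
  have hf : f.1 ∈ closure (ρ.boundedContinuous : Set (BoundedFun ρ)) := f.2
  obtain ⟨g, hg, hgf⟩ := mem_closure_iff_seq_limit.1 hf
  exact ⟨fun n => ⟨g n, Submodule.le_topologicalClosure _ (hg n)⟩, fun n => (hg n).1,
    fun n => (hg n).2, tendsto_subtype_rng.2 hgf⟩

/-- A closed property of elements of `𝓑^ρ(X)` holds for all of them as soon as it holds for the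
bounded continuous functions. -/
theorem isClosed_induction (ρ : AdmissibleWeight X) {p : ρ.calB → Prop} (hp : IsClosed {f | p f})
    (h : ∀ f : ρ.calB, Continuous (fun x => f x) → (∃ C : ℝ, ∀ x, |f x| ≤ C) → p f)
    (f : ρ.calB) : p f := by
  obtain ⟨g, hg, hgb, hgf⟩ := ρ.exists_tendsto_boundedContinuous f
  exact hp.mem_of_tendsto hgf (Eventually.of_forall fun n => h _ (hg n) (hgb n))

/-- `𝓑^ρ(X)` is stable under absolute values, which do not change the norm. -/
theorem exists_abs [T2Space X] (ρ : AdmissibleWeight X) (f : ρ.calB) :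
    ∃ g : ρ.calB, (∀ x, g x = |f x|) ∧ ‖g‖ = ‖f‖ := by
  obtain ⟨g, hg, hgb, hgf⟩ := ρ.exists_tendsto_boundedContinuous f
  let a : BoundedFun ρ := ⟨fun x => |f x|, by
    refine ⟨‖f‖, ?_⟩
    rintro _ ⟨x, rfl⟩
    dsimp only
    rw [abs_abs]
    exact BoundedFun.le_norm f.1 x⟩
  have ha : a ∈ ρ.calB := by
    refine mem_closure_of_tendsto (b := atTop)
      (f := fun n => (ρ.ofBoundedContinuous (fun x => |g n x|) (hg n).abs
        ((hgb n).imp fun _ hC x => (abs_abs _).le.trans (hC x))).1) ?_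
      (Eventually.of_forall fun n => ⟨(hg n).abs, (hgb n).imp fun _ hC x =>
        (abs_abs _).le.trans (hC x)⟩)
    refine tendsto_iff_norm_sub_tendsto_zero.2
      (squeeze_zero (fun n => norm_nonneg _) (fun n => ?_)
        (tendsto_iff_norm_sub_tendsto_zero.1 hgf))
    refine Real.iSup_le (fun x => (div_le_iff₀ (ρ.pos x)).2 ?_) (norm_nonneg _)
    exact (abs_abs_sub_abs_le _ _).trans (ρ.abs_apply_le (g n - f) x)
  refine ⟨⟨a, ha⟩, fun x => rfl, ?_⟩
  change (⨆ x, |(|f x|)| / ρ x) = ⨆ x, |f x| / ρ x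
  simp only [abs_abs]

/-- On a sublevel set of the weight, convergence in the weighted norm is uniform convergence. -/
theorem continuousOn_sublevel (ρ : AdmissibleWeight X) (f : ρ.calB) (R : ℝ) :
    ContinuousOn (fun x => f x) {x | ρ x ≤ R} := by
  obtain ⟨g, hg, hgb, hgf⟩ := ρ.exists_tendsto_boundedContinuous f
  refine TendstoUniformlyOn.continuousOn (F := fun n x => g n x) (p := atTop) ?_
    (Frequently.of_forall fun n => (hg n).continuousOn)
  rw [Metric.tendstoUniformlyOn_iff]
  intro ε hε
  have h := (tendsto_iff_norm_sub_tendsto_zero.1 hgf).mul_const |R|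
  rw [zero_mul] at h
  filter_upwards [h.eventually_lt_const hε] with n hn x hx
  rw [dist_comm, Real.dist_eq]
  refine lt_of_le_of_lt ?_ hn
  exact (ρ.abs_apply_le (g n - f) x).trans
    (mul_le_mul_of_nonneg_left (le_trans hx (le_abs_self R)) (norm_nonneg _))

theorem iUnion_sublevel (ρ : AdmissibleWeight X) :
    ⋃ n : ℕ, {x | ρ x ≤ (n : ℝ) + 1} = Set.univ := by
  refine Set.eq_univ_of_forall fun x => Set.mem_iUnion.2 ?_
  obtain ⟨n, hn⟩ := exists_nat_ge (ρ x)
  exact ⟨n, hn.trans (by simp)⟩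

theorem isCompact_sublevel_nat (ρ : AdmissibleWeight X) (n : ℕ) :
    IsCompact {x | ρ x ≤ (n : ℝ) + 1} :=
  ρ.isCompact_sublevel _ (by positivity)

theorem measurable_apply [MeasurableSpace X] [BorelSpace X] (ρ : AdmissibleWeight X) (f : ρ.calB) :
    Measurable (fun x => f x) := by
  obtain ⟨g, hg, -, hgf⟩ := ρ.exists_tendsto_boundedContinuous f
  refine measurable_of_tendsto_metrizable (f := fun n x => g n x) (fun n => (hg n).measurable)
    (tendsto_pi_nhds.2 fun x => ?_)
  exact ((ρ.evalAt x).continuous.tendsto f).comp hgf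

/-! ### Passage to the Stone–Čech compactification -/

/-- The compactification carries its Borel `σ`-algebra. -/
instance : MeasurableSpace (StoneCech X) := borel _

instance : BorelSpace (StoneCech X) := ⟨rfl⟩

/-- The restriction to `X` of a continuous function on the Stone–Čech compactification, as an
element of `𝓑^ρ(X)`. -/
noncomputable def ofStoneCech [T2Space X] (ρ : AdmissibleWeight X) (f : C(StoneCech X, ℝ)) :
    ρ.calB :=
  ρ.ofBoundedContinuous (fun x => f (stoneCechUnit x)) (f.continuous.comp continuous_stoneCechUnit)
    ⟨‖f‖, fun _ => f.norm_coe_le_norm _⟩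

@[simp] theorem ofStoneCech_apply [T2Space X] (ρ : AdmissibleWeight X) (f : C(StoneCech X, ℝ))
    (x : X) : ρ.ofStoneCech f x = f (stoneCechUnit x) := rfl

/-- Every bounded continuous function on `X` extends to the Stone–Čech compactification. -/
theorem exists_ofStoneCech_eq [T2Space X] (ρ : AdmissibleWeight X) (f : ρ.calB)
    (hf : Continuous fun x => f x) {C : ℝ} (hC : ∀ x, |f x| ≤ C) :
    ∃ g : C(StoneCech X, ℝ), ρ.ofStoneCech g = f := by
  have hf' : Continuous (fun x => ⟨f x, abs_le.1 (hC x)⟩ : X → Set.Icc (-C) C) := hf.subtype_mk _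
  refine ⟨⟨fun z => Subtype.val (stoneCechExtend hf' z),
    continuous_subtype_val.comp (continuous_stoneCechExtend hf')⟩, ?_⟩
  refine Subtype.ext (Subtype.ext (funext fun x => ?_))
  change Subtype.val (stoneCechExtend hf' (stoneCechUnit x)) = f x
  rw [stoneCechExtend_stoneCechUnit]

/-- `X` is `σ`-compact, hence a Borel subset of its Stone–Čech compactification. -/
theorem measurableEmbedding_stoneCechUnit [T35Space X] [MeasurableSpace X] [BorelSpace X]
    (ρ : AdmissibleWeight X) : MeasurableEmbedding (stoneCechUnit : X → StoneCech X) := by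
  refine isEmbedding_stoneCechUnit.measurableEmbedding ?_
  rw [← Set.image_univ, ← ρ.iUnion_sublevel, Set.image_iUnion]
  exact MeasurableSet.iUnion fun n =>
    ((ρ.isCompact_sublevel_nat n).image continuous_stoneCechUnit).measurableSet

/-- A Borel measurable left inverse of the inclusion of `X` into its Stone–Čech compactification.
Its values outside of `X` are arbitrary. -/
theorem exists_measurable_retraction [T35Space X] [MeasurableSpace X] [BorelSpace X] [Nonempty X]
    (ρ : AdmissibleWeight X) :
    ∃ r : StoneCech X → X, Measurable r ∧ ∀ x, r (stoneCechUnit x) = x := by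
  obtain ⟨r, hr, h⟩ := ρ.measurableEmbedding_stoneCechUnit.exists_measurable_extend measurable_id
    fun _ => inferInstance
  exact ⟨r, hr, congrFun h⟩

/-! ### Representing measures -/

section Law

variable [T35Space X] (ρ : AdmissibleWeight X) {Z : Type*} [TopologicalSpace Z] [CompactSpace Z]
  [T2Space Z] [MeasurableSpace Z] [BorelSpace Z] (m : Measure Z) [IsFiniteMeasure m] [m.Regular]
  {φ : Z → StoneCech X} (hφ : Continuous φ) (T : ρ.calB →L[ℝ] ℝ)
  (hm : ∀ f : C(StoneCech X, ℝ), ∫ z, f (φ z) ∂m = T (ρ.ofStoneCech f))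

include hφ hm in
/-- The continuity of the functional with respect to the weighted norm is tightness: the
representing measure on the compactification does not charge the complement of `X`. A continuous
function with values in `[0, 1]` vanishing on `{ρ ≤ R}` has weighted norm at most `1 / R`. -/
theorem ae_mem_range_stoneCechUnit :
    ∀ᵐ z ∂m, φ z ∈ Set.range (stoneCechUnit : X → StoneCech X) := by
  have key : ∀ n : ℕ, m (φ ⁻¹' (stoneCechUnit '' {x | ρ x ≤ (n : ℝ) + 1})ᶜ)
      ≤ ENNReal.ofReal (‖T‖ * (1 / ((n : ℝ) + 1))) := by
    intro n
    have hK : IsCompact (stoneCechUnit '' {x | ρ x ≤ (n : ℝ) + 1}) :=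
      (ρ.isCompact_sublevel_nat n).image continuous_stoneCechUnit
    refine measure_preimage_le_of_integral_le m hφ hK.isClosed.isOpen_compl fun f hf hf0 => ?_
    rw [hm]
    refine ENNReal.ofReal_le_ofReal ((le_abs_self _).trans ((T.le_opNorm _).trans ?_))
    refine mul_le_mul_of_nonneg_left (ρ.norm_le_of_abs_le _ (by positivity) fun x => ?_)
      (norm_nonneg T)
    rw [ofStoneCech_apply]
    by_cases hx : ρ x ≤ (n : ℝ) + 1
    · rw [hf0 _ (fun h => h ⟨x, hx, rfl⟩), abs_zero]
      exact mul_nonneg (by positivity) (ρ.pos x).le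
    · rw [abs_of_nonneg (hf _).1, one_div_mul_eq_div, le_div_iff₀ (by positivity)]
      exact (mul_le_of_le_one_left (by positivity) (hf _).2).trans (not_le.1 hx).le
  have hlim : Tendsto (fun n : ℕ => ENNReal.ofReal (‖T‖ * (1 / ((n : ℝ) + 1)))) atTop (𝓝 0) := by
    rw [← ENNReal.ofReal_zero, ← mul_zero ‖T‖]
    exact ENNReal.tendsto_ofReal (tendsto_one_div_add_atTop_nhds_zero_nat.const_mul _)
  refine le_antisymm (ge_of_tendsto' hlim fun n => le_trans (measure_mono ?_) (key n)) bot_le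
  rintro z hz ⟨x, -, hx⟩
  exact hz ⟨x, hx⟩

include hφ hm in
/-- The retraction `r` of the compactification onto `X` is not continuous, but almost surely it
leaves `φ` in place. -/
theorem ae_apply_retraction_eq {r : StoneCech X → X} (hru : ∀ x, r (stoneCechUnit x) = x)
    (f : C(StoneCech X, ℝ)) :
    ∀ᵐ z ∂m, ρ.ofStoneCech f (r (φ z)) = f (φ z) := by
  filter_upwards [ρ.ae_mem_range_stoneCechUnit m hφ T hm] with z ⟨x, hx⟩
  rw [ofStoneCech_apply, ← hx, hru]

variable [MeasurableSpace X] [BorelSpace X] {r : StoneCech X → X} (hr : Measurable r)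
  (hru : ∀ x, r (stoneCechUnit x) = x)

include hφ hm hr hru in
/-- Since `|f| ∈ 𝓑^ρ(X)`, the `L¹` norm is controlled by the weighted norm: for bounded continuous
functions it is a value of `T`, and Fatou's lemma covers their limits. -/
theorem lintegral_enorm_retraction_le (f : ρ.calB) :
    ∫⁻ z, ‖f (r (φ z))‖ₑ ∂m ≤ ENNReal.ofReal (‖T‖ * ‖f‖) := by
  obtain ⟨g, hg, hgb, hgf⟩ := ρ.exists_tendsto_boundedContinuous f
  have hmeas : ∀ h : ρ.calB, Measurable fun z => h (r (φ z)) := fun h =>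
    (ρ.measurable_apply h).comp (hr.comp hφ.measurable)
  have hgn : ∀ n, ∫⁻ z, ‖g n (r (φ z))‖ₑ ∂m ≤ ENNReal.ofReal (‖T‖ * ‖g n‖) := by
    intro n
    obtain ⟨a, ha, han⟩ := ρ.exists_abs (g n)
    obtain ⟨C, hC⟩ := hgb n
    obtain ⟨a', rfl⟩ := ρ.exists_ofStoneCech_eq a (by simpa only [ha] using (hg n).abs) (C := C)
      (fun x => by rw [ha, abs_abs]; exact hC x)
    have hae := ρ.ae_apply_retraction_eq m hφ T hm hru a'
    have h1 : ∫⁻ z, ‖g n (r (φ z))‖ₑ ∂m = ∫⁻ z, ENNReal.ofReal (a' (φ z)) ∂m := by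
      refine lintegral_congr_ae (hae.mono fun z hz => ?_)
      dsimp only
      rw [← hz, ha, Real.enorm_eq_ofReal_abs]
    rw [h1, ← ofReal_integral_eq_lintegral_ofReal, hm, ← han]
    · exact ENNReal.ofReal_le_ofReal ((le_abs_self _).trans (T.le_opNorm _))
    · exact (a'.comp ⟨φ, hφ⟩).continuous.integrable_of_hasCompactSupport
        (HasCompactSupport.of_compactSpace _)
    · refine hae.mono fun z hz => ?_
      dsimp only
      rw [← hz, ha]
      exact abs_nonneg _
  calc ∫⁻ z, ‖f (r (φ z))‖ₑ ∂m
      = ∫⁻ z, liminf (fun n => ‖g n (r (φ z))‖ₑ) atTop ∂m := by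
        refine lintegral_congr fun z => (Tendsto.liminf_eq ?_).symm
        exact (((ρ.evalAt (r (φ z))).continuous.tendsto f).comp hgf).enorm
    _ ≤ liminf (fun n => ∫⁻ z, ‖g n (r (φ z))‖ₑ ∂m) atTop :=
        lintegral_liminf_le fun n => (hmeas (g n)).enorm
    _ ≤ liminf (fun n => ENNReal.ofReal (‖T‖ * ‖g n‖)) atTop :=
        liminf_le_liminf (Eventually.of_forall hgn)
    _ = ENNReal.ofReal (‖T‖ * ‖f‖) :=
        (ENNReal.tendsto_ofReal (hgf.norm.const_mul _)).liminf_eq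

include hφ hm hr hru in
theorem integrable_retraction (f : ρ.calB) : Integrable (fun z => f (r (φ z))) m :=
  ⟨((ρ.measurable_apply f).comp (hr.comp hφ.measurable)).aestronglyMeasurable,
    (ρ.lintegral_enorm_retraction_le m hφ T hm hr hru f).trans_lt ENNReal.ofReal_lt_top⟩

include hφ hm hr hru in
theorem integral_abs_retraction_le (f : ρ.calB) : ∫ z, |f (r (φ z))| ∂m ≤ ‖T‖ * ‖f‖ := by
  have h := ρ.lintegral_enorm_retraction_le m hφ T hm hr hru f
  have hi := ρ.integrable_retraction m hφ T hm hr hru f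
  rw [← ofReal_integral_norm_eq_lintegral_enorm hi] at h
  exact (ENNReal.ofReal_le_ofReal_iff (by positivity)).1 h

include hφ hm hr hru in
/-- The set integrals of `f (r (φ z))` depend continuously on `f ∈ 𝓑^ρ(X)`. -/
theorem continuous_setIntegral_retraction (A : Set Z) :
    Continuous fun f : ρ.calB => ∫ z in A, f (r (φ z)) ∂m := by
  have hi := ρ.integrable_retraction m hφ T hm hr hru
  let L : ρ.calB →ₗ[ℝ] ℝ :=
    { toFun := fun f => ∫ z in A, f (r (φ z)) ∂m
      map_add' := fun f g => integral_add (hi f).integrableOn (hi g).integrableOn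
      map_smul' := fun c f => integral_const_mul c _ }
  refine (L.mkContinuous ‖T‖ fun f => ?_).continuous
  refine (norm_integral_le_integral_norm _).trans ((setIntegral_le_integral (hi f).norm
    (ae_of_all _ fun z => norm_nonneg _)).trans ?_)
  exact ρ.integral_abs_retraction_le m hφ T hm hr hru f

include hφ hm hr hru in
/-- A measure that represents `T` on the bounded continuous functions represents it on all of
`𝓑^ρ(X)`, including the unbounded functions. -/
theorem integral_retraction (f : ρ.calB) : ∫ z, f (r (φ z)) ∂m = T f := by
  refine ρ.isClosed_induction (p := fun f => ∫ z, f (r (φ z)) ∂m = T f) ?_ (fun g hg hgb => ?_) f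
  · have h := ρ.continuous_setIntegral_retraction m hφ T hm hr hru Set.univ
    simp only [setIntegral_univ] at h
    exact isClosed_eq h T.continuous
  · obtain ⟨C, hC⟩ := hgb
    obtain ⟨g', rfl⟩ := ρ.exists_ofStoneCech_eq g hg hC
    rw [← hm]
    exact integral_congr_ae (ρ.ae_apply_retraction_eq m hφ T hm hru g')

end Law

/-! ### Transition kernels -/

/-- A supremum of functions that are continuous on the sublevel sets of the weight is Borel
measurable, even if the family is uncountable: it is lower semicontinuous on each of the countably
many closed sets `{ρ ≤ n + 1}`. -/
theorem measurable_iSup_of_continuousOn_sublevel [T2Space X] [MeasurableSpace X] [BorelSpace X]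
    (ρ : AdmissibleWeight X) {ι : Sort*} {F : ι → X → ℝ≥0∞}
    (hF : ∀ i (R : ℝ), ContinuousOn (F i) {x | ρ x ≤ R}) : Measurable fun x => ⨆ i, F i x := by
  refine measurable_of_Ioi fun a => ?_
  have h : ∀ (n : ℕ) (i : ι), ∃ u : Set X, IsOpen u ∧
      F i ⁻¹' Set.Ioi a ∩ {x | ρ x ≤ (n : ℝ) + 1} = u ∩ {x | ρ x ≤ (n : ℝ) + 1} := fun n i =>
    continuousOn_iff'.1 (hF i _) _ isOpen_Ioi
  choose u hu huF using h
  have hset : (fun x => ⨆ i, F i x) ⁻¹' Set.Ioi a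
      = ⋃ n : ℕ, (⋃ i, u n i) ∩ {x | ρ x ≤ (n : ℝ) + 1} := by
    simp_rw [Set.iUnion_inter, ← huF, ← Set.iUnion_inter]
    rw [← Set.inter_iUnion, ρ.iUnion_sublevel, Set.inter_univ]
    ext x
    simp [lt_iSup_iff]
  rw [hset]
  exact MeasurableSet.iUnion fun n => (isOpen_iUnion (hu n)).measurableSet.inter
    (ρ.isCompact_sublevel_nat n).measurableSet

/-- Restriction of continuous functions from the Stone–Čech compactification, as a linear map. -/
noncomputable def ofStoneCechₗ [T2Space X] (ρ : AdmissibleWeight X) :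
    C(StoneCech X, ℝ) →ₗ[ℝ] ρ.calB where
  toFun := ρ.ofStoneCech
  map_add' _ _ := rfl
  map_smul' _ _ := rfl

theorem exists_regular_measure_stoneCech [T2Space X] (ρ : AdmissibleWeight X) (T : ρ.calB →L[ℝ] ℝ)
    (hT : ∀ f : ρ.calB, (∀ x, 0 ≤ f x) → 0 ≤ T f) :
    ∃ m : Measure (StoneCech X), m.Regular ∧ IsFiniteMeasure m ∧
      ∀ f : C(StoneCech X, ℝ), ∫ z, f z ∂m = T (ρ.ofStoneCech f) :=
  exists_regular_measure_of_nonneg (T.toLinearMap.comp ρ.ofStoneCechₗ) fun _ hf =>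
    hT _ fun _ => hf _

/-- A positive operator on `𝓑^ρ(X)` that fixes the constant `1` is given by a Markov kernel. -/
theorem exists_kernel [T35Space X] [MeasurableSpace X] [BorelSpace X] (ρ : AdmissibleWeight X)
    (Q : ρ.calB →L[ℝ] ρ.calB) (hQ : ∀ f : ρ.calB, (∀ x, 0 ≤ f x) → ∀ x, 0 ≤ Q f x)
    (hQ1 : Q ρ.one = ρ.one) :
    ∃ κ : ProbabilityTheory.Kernel X X, ProbabilityTheory.IsMarkovKernel κ ∧
      ∀ (f : ρ.calB) (x : X), ∫ y, f y ∂(κ x) = Q f x := by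
  cases isEmpty_or_nonempty X
  · exact ⟨0, ⟨fun x => isEmptyElim x⟩, fun _ x => isEmptyElim x⟩
  obtain ⟨r, hr, hru⟩ := ρ.exists_measurable_retraction
  choose m hmr hmf hm using fun x =>
    ρ.exists_regular_measure_stoneCech ((ρ.evalAt x).comp Q) fun f hf => hQ f hf x
  have hprob : ∀ x, IsProbabilityMeasure (m x) := by
    intro x
    have h := hm x 1
    have h1 : ρ.ofStoneCech 1 = ρ.one := rfl
    rw [h1, ContinuousLinearMap.comp_apply, hQ1, evalAt_apply] at h
    have h2 : ρ.one x = 1 := rfl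
    simp only [ContinuousMap.one_apply, integral_const, smul_eq_mul, mul_one, h2] at h
    refine ⟨?_⟩
    rw [measureReal_def] at h
    rw [← ENNReal.ofReal_toReal (measure_ne_top (m x) Set.univ), h, ENNReal.ofReal_one]
  have hmap : ∀ x, IsProbabilityMeasure ((m x).map r) := fun x =>
    Measure.isProbabilityMeasure_map hr.aemeasurable
  -- The mass of an open set is a supremum of values of functions in `𝓑^ρ(X)`.
  have hopen : ∀ V : Set (StoneCech X), IsOpen V → ∀ x, m x V =
      ⨆ f : {f : C(StoneCech X, ℝ) // (∀ z, f z ∈ Set.Icc (0 : ℝ) 1) ∧ ∀ z ∉ V, f z = 0},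
        ENNReal.ofReal (Q (ρ.ofStoneCech f) x) := by
    intro V hV x
    refine le_antisymm ?_ (iSup_le ?_)
    · refine measure_preimage_le_of_integral_le (m x) continuous_id hV fun f hf hf0 => ?_
      exact (congrArg ENNReal.ofReal (hm x f)).le.trans
        (le_iSup (fun f : {f : C(StoneCech X, ℝ) // (∀ z, f z ∈ Set.Icc (0 : ℝ) 1) ∧
          ∀ z ∉ V, f z = 0} => ENNReal.ofReal (Q (ρ.ofStoneCech f) x)) ⟨f, hf, hf0⟩)
    · rintro ⟨f, hf, hf0⟩
      have h := hm x f
      rw [ContinuousLinearMap.comp_apply, evalAt_apply] at h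
      rw [← h, ofReal_integral_eq_lintegral_ofReal (f.continuous.integrable_of_hasCompactSupport
        (HasCompactSupport.of_compactSpace _)) (ae_of_all _ fun z => (hf z).1)]
      refine le_trans (lintegral_mono (g := V.indicator 1) fun z => ?_)
        (lintegral_indicator_one hV.measurableSet).le
      by_cases hz : z ∈ V
      · simpa [hz] using (hf z).2
      · simp [hz, hf0 z hz]
  -- Open sets of `X` are traces of open sets of the compactification, and `m x` lives on `X`.
  have hmeas : Measurable fun x => (m x).map r := by
    refine Measurable.measure_of_isPiSystem_of_isProbabilityMeasure
      BorelSpace.measurable_eq isPiSystem_isOpen fun U hU => ?_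
    obtain ⟨V, hV, rfl⟩ := isEmbedding_stoneCechUnit.isInducing.isOpen_iff.1 hU
    have h : ∀ x, (m x).map r (stoneCechUnit ⁻¹' V) = m x V := by
      intro x
      rw [Measure.map_apply hr hU.measurableSet]
      refine measure_congr ?_
      filter_upwards [ρ.ae_mem_range_stoneCechUnit (m x) continuous_id _ (hm x)] with z ⟨y, hy⟩
      change (r z ∈ stoneCechUnit ⁻¹' V) = (z ∈ V)
      rw [id] at hy
      rw [Set.mem_preimage, ← hy, hru]
    simp_rw [h, hopen V hV]
    exact ρ.measurable_iSup_of_continuousOn_sublevel fun f R =>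
      ENNReal.continuous_ofReal.comp_continuousOn (ρ.continuousOn_sublevel _ R)
  refine ⟨⟨fun x => (m x).map r, hmeas⟩, ⟨hmap⟩, fun f x => ?_⟩
  change ∫ y, f y ∂((m x).map r) = Q f x
  rw [integral_map hr.aemeasurable (ρ.measurable_apply f).aestronglyMeasurable]
  exact ρ.integral_retraction (m x) continuous_id _ (hm x) hr hru f

/-! ### Markovian laws at finitely many times -/

/-- A positive operator that fixes the constant `1` preserves bounds in the uniform norm. -/
theorem abs_apply_le_of_abs_le [T2Space X] (ρ : AdmissibleWeight X) {Q : ρ.calB →L[ℝ] ρ.calB}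
    (hQ : ∀ f : ρ.calB, (∀ x, 0 ≤ f x) → ∀ x, 0 ≤ Q f x) (hQ1 : Q ρ.one = ρ.one) {f : ρ.calB}
    {C : ℝ} (hf : ∀ x, |f x| ≤ C) (x : X) : |Q f x| ≤ C := by
  have h1 : ∀ y, ρ.one y = 1 := fun _ => rfl
  have hC : ∀ y, (C • ρ.one) y = C := fun y => mul_one C
  have hsub := hQ (C • ρ.one - f) (fun y => sub_nonneg.2 ((abs_le.1 (hf y)).2.trans (hC y).ge)) x
  have hadd := hQ (C • ρ.one + f)
    (fun y => by
      change 0 ≤ (C • ρ.one) y + f y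
      rw [hC]; linarith [(abs_le.1 (hf y)).1]) x
  rw [map_sub, map_smul, hQ1] at hsub
  rw [map_add, map_smul, hQ1] at hadd
  change 0 ≤ (C • ρ.one) x - Q f x at hsub
  change 0 ≤ (C • ρ.one) x + Q f x at hadd
  rw [hC] at hsub hadd
  exact abs_le.2 ⟨by linarith, by linarith⟩

/-- Continuing a random path from its position at time `b`: the position at time `a` is replaced by
a point drawn from the kernel `κ`. -/
noncomputable def extendLaw {X : Type u} [MeasurableSpace X] (μ : Measure (ℝ≥0 → X))
    (κ : ProbabilityTheory.Kernel X X) (b a : ℝ≥0) : Measure (ℝ≥0 → X) :=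
  (μ.compProd (κ.comap (fun w : ℝ≥0 → X => w b) (measurable_pi_apply b))).map
    fun p => Function.update p.1 a p.2

section ExtendLaw

variable {X : Type u} [MeasurableSpace X] (μ : Measure (ℝ≥0 → X)) [IsProbabilityMeasure μ]
  (κ : ProbabilityTheory.Kernel X X) [ProbabilityTheory.IsMarkovKernel κ] (b a : ℝ≥0)

instance : IsProbabilityMeasure (extendLaw μ κ b a) :=
  Measure.isProbabilityMeasure_map measurable_update'.aemeasurable

theorem integral_extendLaw {H : (ℝ≥0 → X) → ℝ} (hH : Measurable H) {C : ℝ}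
    (hC : ∀ w, |H w| ≤ C) : ∫ w, H w ∂(extendLaw μ κ b a)
      = ∫ w, ∫ y, H (Function.update w a y) ∂(κ (w b)) ∂μ := by
  have hHm : Measurable fun p : (ℝ≥0 → X) × X => H (Function.update p.1 a p.2) :=
    hH.comp measurable_update'
  rw [extendLaw, integral_map measurable_update'.aemeasurable hH.aestronglyMeasurable,
    Measure.integral_compProd]
  · rfl
  · exact Integrable.of_bound hHm.aestronglyMeasurable C (ae_of_all _ fun p => hC _)

theorem integral_extendLaw_of_forall_update {H : (ℝ≥0 → X) → ℝ} (hH : Measurable H) {C : ℝ}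
    (hC : ∀ w, |H w| ≤ C) (hup : ∀ w y, H (Function.update w a y) = H w) :
    ∫ w, H w ∂(extendLaw μ κ b a) = ∫ w, H w ∂μ := by
  rw [integral_extendLaw μ κ b a hH hC]
  simp [hup]

end ExtendLaw

/-- For every finite set of times there is a law on path space under which the path, observed at
these times, is a Markov chain started at `x₀` with the transition operators of the semigroup. The
path functionals `G` are those that depend on the path up to time `s` only. The law is constructed
by adding the times in increasing order; the Markov property between nonadjacent times follows from
`P (t + s) = P t ∘ P s` on `𝓑^ρ(X)`, so that no Chapman–Kolmogorov equation for kernels on Borel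
sets is needed. -/
theorem IsGeneralizedFeller.exists_finite_markov_law [T35Space X] [MeasurableSpace X]
    [BorelSpace X] {ρ : AdmissibleWeight X} {P : ℝ≥0 → ρ.calB →L[ℝ] ρ.calB}
    (hP : ρ.IsGeneralizedFeller P) (hone : ∀ t : ℝ≥0, P t ρ.one = ρ.one) (x₀ : X)
    (J : Finset ℝ≥0) :
    ∃ μ : Measure (ℝ≥0 → X), IsProbabilityMeasure μ ∧
      (∀ f : ρ.calB, (∃ C : ℝ, ∀ x, |f x| ≤ C) → ∫ w, f (w 0) ∂μ = f x₀) ∧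
      ∀ s ∈ insert 0 J, ∀ t ∈ insert 0 J, s ≤ t → ∀ f : ρ.calB, (∃ C : ℝ, ∀ x, |f x| ≤ C) →
        ∀ G : (ℝ≥0 → X) → ℝ, Measurable G → (∃ C : ℝ, ∀ w, |G w| ≤ C) →
          (∀ w w', (∀ u ≤ s, w u = w' u) → G w = G w') →
          ∫ w, G w * f (w t) ∂μ = ∫ w, G w * P (t - s) f (w s) ∂μ := by
  have hself : ∀ (t : ℝ≥0) (f : ρ.calB), P (t - t) f = f := fun t f => by
    rw [tsub_self, hP.zero]; rfl
  have hfm : ∀ (f : ρ.calB) (u : ℝ≥0), Measurable fun w : ℝ≥0 → X => f (w u) := fun f u =>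
    (ρ.measurable_apply f).comp (measurable_pi_apply u)
  induction J using Finset.induction_on_max with
  | empty =>
    refine ⟨Measure.dirac fun _ => x₀, inferInstance, fun f _ => ?_, ?_⟩
    · exact integral_dirac' _ _ (hfm f 0).stronglyMeasurable
    · intro s hs t ht _ f _ G _ _ _
      simp only [insert_empty_eq, Finset.mem_singleton] at hs ht
      rw [hs, ht, hself]
  | insert a J haJ ih =>
    obtain ⟨μ, hμ, hμ0, hμm⟩ := ih
    rcases eq_or_ne a 0 with rfl | ha0
    · exact ⟨μ, hμ, hμ0, by simpa only [Finset.insert_idem] using hμm⟩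
    have hlt : ∀ u ∈ insert 0 J, u < a := by
      intro u hu
      rcases Finset.mem_insert.1 hu with rfl | hu
      · exact pos_iff_ne_zero.2 ha0
      · exact haJ u hu
    -- The chain is continued from the last time `b` before `a`.
    obtain ⟨b, hb, hbmax⟩ := (insert 0 J).exists_max_image id ⟨0, Finset.mem_insert_self _ _⟩
    obtain ⟨κ, hκ, hκP⟩ := ρ.exists_kernel (P (a - b)) (hP.positive _) (hone _)
    refine ⟨extendLaw μ κ b a, inferInstance, fun f hf => ?_, ?_⟩
    · obtain ⟨C, hC⟩ := hf
      rw [integral_extendLaw_of_forall_update μ κ b a (hfm f 0) (fun w => hC _) fun w y => by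
        rw [Function.update_of_ne ha0.symm], hμ0 f ⟨C, hC⟩]
    intro s hs t ht hst f hf G hG hGb hGs
    obtain ⟨C, hC⟩ := hf
    obtain ⟨D, hD⟩ := hGb
    have hbd : ∀ (g : ρ.calB), (∀ x, |g x| ≤ C) → ∀ (u : ℝ≥0) (w : ℝ≥0 → X),
        |G w * g (w u)| ≤ D * C := fun g hg u w => by
      rw [abs_mul]
      exact mul_le_mul (hD w) (hg _) (abs_nonneg _) ((abs_nonneg _).trans (hD w))
    have hPf : ∀ (u : ℝ≥0) (x : X), |P u f x| ≤ C := fun u =>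
      ρ.abs_apply_le_of_abs_le (hP.positive u) (hone u) hC
    rcases eq_or_ne s a with rfl | hsa
    · have hts : t = s := by
        refine le_antisymm ?_ hst
        rw [Finset.insert_comm] at ht
        rcases Finset.mem_insert.1 ht with rfl | ht
        · exact le_rfl
        · exact (hlt t ht).le
      rw [hts, hself]
    have hsJ : s ∈ insert 0 J := by
      rw [Finset.insert_comm] at hs
      exact (Finset.mem_insert.1 hs).resolve_left hsa
    have hGup : ∀ w y, G (Function.update w a y) = G w := fun w y =>
      hGs _ _ fun u hu => Function.update_of_ne (hu.trans_lt (hlt s hsJ)).ne _ _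
    rw [integral_extendLaw_of_forall_update μ κ b a (H := fun w => G w * P (t - s) f (w s))
      (hG.mul (hfm _ s)) (hbd _ (hPf _) s) fun w y => by
        rw [hGup, Function.update_of_ne hsa]]
    rcases eq_or_ne t a with rfl | hta
    · rw [integral_extendLaw μ κ b t (H := fun w => G w * f (w t)) (hG.mul (hfm f t)) (hbd f hC t)]
      simp only [hGup, Function.update_self, integral_const_mul, hκP]
      rw [hμm s hsJ b hb (hbmax s hsJ) (P (t - b) f) ⟨C, hPf _⟩ G hG ⟨D, hD⟩ hGs,
        ← ContinuousLinearMap.comp_apply, ← hP.add, add_comm,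
        tsub_add_tsub_cancel (hlt b hb).le (show s ≤ b from hbmax s hsJ)]
    · have htJ : t ∈ insert 0 J := by
        rw [Finset.insert_comm] at ht
        exact (Finset.mem_insert.1 ht).resolve_left hta
      rw [integral_extendLaw_of_forall_update μ κ b a (H := fun w => G w * f (w t))
        (hG.mul (hfm f t)) (hbd f hC t) fun w y => by
          rw [hGup, Function.update_of_ne hta]]
      exact hμm s hsJ t htJ hst f ⟨C, hC⟩ G hG ⟨D, hD⟩ hGs

end AdmissibleWeight

/-! ### Limits of laws along an ultrafilter -/

/-- Along an ultrafilter, the images of probability measures under a map into a compact Hausdorff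
space converge to a regular probability measure, in the sense of integrals of continuous functions.
The images need not be Borel measures: it is enough that continuous functions pull back to
measurable ones. -/
theorem exists_regular_limit {ι W Z : Type*} (𝒰 : Ultrafilter ι) [MeasurableSpace W]
    [TopologicalSpace Z] [CompactSpace Z] [T2Space Z] [MeasurableSpace Z] [BorelSpace Z]
    (μ : ι → Measure W) [∀ i, IsProbabilityMeasure (μ i)] (Φ : W → Z)
    (hΦ : ∀ F : C(Z, ℝ), Measurable fun w => F (Φ w)) :
    ∃ m : Measure Z, m.Regular ∧ IsProbabilityMeasure m ∧
      ∀ F : C(Z, ℝ), Tendsto (fun i => ∫ w, F (Φ w) ∂(μ i)) 𝒰 (𝓝 (∫ z, F z ∂m)) := by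
  have hint : ∀ (F : C(Z, ℝ)) (i : ι), Integrable (fun w => F (Φ w)) (μ i) := fun F i =>
    Integrable.of_bound (hΦ F).aestronglyMeasurable ‖F‖ (ae_of_all _ fun w => F.norm_coe_le_norm _)
  have hlim : ∀ F : C(Z, ℝ), ∃ l : ℝ, Tendsto (fun i => ∫ w, F (Φ w) ∂(μ i)) 𝒰 (𝓝 l) := by
    intro F
    have hb : ∀ i, ∫ w, F (Φ w) ∂(μ i) ∈ Set.Icc (-‖F‖) ‖F‖ := fun i => by
      refine abs_le.1 ((norm_integral_le_of_norm_le_const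
        (ae_of_all _ fun w => F.norm_coe_le_norm (Φ w))).trans ?_)
      simp
    obtain ⟨l, -, hl⟩ := isCompact_Icc.ultrafilter_le_nhds
      (𝒰.map fun i => ∫ w, F (Φ w) ∂(μ i))
        (le_principal_iff.2 (Ultrafilter.mem_map.2 (Eventually.of_forall hb)))
    exact ⟨l, hl⟩
  choose l hl using hlim
  let Λ : C(Z, ℝ) →ₗ[ℝ] ℝ :=
    { toFun := l
      map_add' := fun F G => tendsto_nhds_unique (hl (F + G)) <| ((hl F).add (hl G)).congr fun i =>
        (integral_add (hint F i) (hint G i)).symm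
      map_smul' := fun c F => tendsto_nhds_unique (hl (c • F)) <|
        ((hl F).const_mul c).congr fun i =>
          (integral_const_mul c _).symm }
  obtain ⟨m, hmr, hmf, hm⟩ := exists_regular_measure_of_nonneg Λ fun F hF =>
    ge_of_tendsto' (hl F) fun i => integral_nonneg fun w => hF _
  refine ⟨m, hmr, ⟨?_⟩, fun F => by rw [hm]; exact hl F⟩
  have h1 : (∫ z, (1 : C(Z, ℝ)) z ∂m) = 1 := by
    rw [hm]
    refine tendsto_nhds_unique (hl 1) (tendsto_const_nhds.congr fun i => ?_)
    simp
  simp only [ContinuousMap.one_apply, integral_const, smul_eq_mul, mul_one, measureReal_def] at h1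
  rw [← ENNReal.ofReal_toReal (measure_ne_top m Set.univ), h1, ENNReal.ofReal_one]

/-- The space of all paths in the Stone–Čech compactification of `X`, a compact Hausdorff space for
the product topology. It is a type of its own because it carries the Borel `σ`-algebra of the
product topology, which is larger than the product `σ`-algebra. -/
def PathSpace (X : Type u) [TopologicalSpace X] : Type u := ℝ≥0 → StoneCech X

namespace PathSpace

variable {X : Type u} [TopologicalSpace X]

instance : TopologicalSpace (PathSpace X) :=
  inferInstanceAs (TopologicalSpace (ℝ≥0 → StoneCech X))

instance : CompactSpace (PathSpace X) := inferInstanceAs (CompactSpace (ℝ≥0 → StoneCech X))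

instance : T2Space (PathSpace X) := inferInstanceAs (T2Space (ℝ≥0 → StoneCech X))

instance : MeasurableSpace (PathSpace X) := borel _

instance : BorelSpace (PathSpace X) := ⟨rfl⟩

/-- The position of a path at time `t`. -/
def eval (t : ℝ≥0) : C(PathSpace X, StoneCech X) :=
  ⟨fun z => z t, continuous_apply (A := fun _ : ℝ≥0 => StoneCech X) t⟩

/-- A path in `X`, viewed as a path in the compactification. -/
def ofPath (w : ℝ≥0 → X) : PathSpace X := fun t => stoneCechUnit (w t)

@[simp] theorem eval_ofPath (t : ℝ≥0) (w : ℝ≥0 → X) :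
    eval t (ofPath w) = stoneCechUnit (w t) := rfl

/-- By the Stone–Weierstrass theorem, continuous functions on the path space of the
compactification depend measurably on the coordinates. -/
theorem measurable_comp_ofPath [MeasurableSpace X] [OpensMeasurableSpace X]
    (F : C(PathSpace X, ℝ)) : Measurable fun w : ℝ≥0 → X => F (ofPath w) := by
  let A : Subalgebra ℝ C(PathSpace X, ℝ) :=
    { carrier := {F | Measurable fun w : ℝ≥0 → X => F (ofPath w)}
      mul_mem' := fun hF hG => Measurable.mul hF hG
      add_mem' := fun hF hG => Measurable.add hF hG
      algebraMap_mem' := fun c => measurable_const }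
  have hA : A.SeparatesPoints := by
    intro z z' hzz'
    obtain ⟨t, ht⟩ := Function.ne_iff.1 hzz'
    obtain ⟨g, hg0, hg1, -⟩ := exists_continuous_zero_one_of_isClosed
      (isClosed_singleton (x := z t)) (isClosed_singleton (x := z' t))
      (Set.disjoint_singleton.2 ht)
    refine ⟨_, ⟨g.comp (eval t), ?_, rfl⟩, ?_⟩
    · exact (g.continuous.comp continuous_stoneCechUnit).measurable.comp (measurable_pi_apply t)
    · have h0 : g (z t) = 0 := hg0 rfl
      have h1 : g (z' t) = 1 := hg1 rfl
      change g (z t) ≠ g (z' t)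
      rw [h0, h1]
      exact zero_ne_one
  have hF : F ∈ A.topologicalClosure := by
    rw [ContinuousMap.subalgebra_topologicalClosure_eq_top_of_separatesPoints A hA]
    trivial
  obtain ⟨G, hG, hGF⟩ := mem_closure_iff_seq_limit.1 hF
  exact measurable_of_tendsto_metrizable (f := fun n w => G n (ofPath w)) hG
    (tendsto_pi_nhds.2 fun w => ((ContinuousEvalConst.continuous_eval_const
      (F := C(PathSpace X, ℝ)) (ofPath w)).tendsto F).comp hGF)

end PathSpace

namespace AdmissibleWeight

open PathSpace

variable {X : Type u} [TopologicalSpace X]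

/-! ### The law of the process on the path space of the compactification -/

section PathLaw

variable [T35Space X] [MeasurableSpace X] [BorelSpace X] {ρ : AdmissibleWeight X}
  {P : ℝ≥0 → ρ.calB →L[ℝ] ρ.calB} {r : StoneCech X → X}

/-- The law of the process started at `x₀`, obtained as a limit of laws that are Markovian at
finitely many times, along an ultrafilter of finite sets of times. The Markov property holds for
functionals `G` that are continuous and depend on the path up to time `s` only. -/
theorem IsGeneralizedFeller.exists_law (hP : ρ.IsGeneralizedFeller P)
    (hone : ∀ t : ℝ≥0, P t ρ.one = ρ.one) (hr : Measurable r)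
    (hru : ∀ x, r (stoneCechUnit x) = x) (x₀ : X) :
    ∃ m : Measure (PathSpace X), m.Regular ∧ IsProbabilityMeasure m ∧
      (∀ (t : ℝ≥0) (f : C(StoneCech X, ℝ)),
        ∫ z, f (eval t z) ∂m = (ρ.evalAt x₀).comp (P t) (ρ.ofStoneCech f)) ∧
      ∀ s t : ℝ≥0, s ≤ t → ∀ G : C(PathSpace X, ℝ),
        (∀ z z', (∀ u ≤ s, eval u z = eval u z') → G z = G z') → ∀ f : C(StoneCech X, ℝ),
          ∫ z, G z * f (eval t z) ∂m
            = ∫ z, G z * P (t - s) (ρ.ofStoneCech f) (r (eval s z)) ∂m := by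
  choose μ hμ hμ0 hμm using hP.exists_finite_markov_law hone x₀
  let 𝒰 : Ultrafilter (Finset ℝ≥0) := Ultrafilter.of atTop
  obtain ⟨m, hmr, hmp, hm⟩ := exists_regular_limit 𝒰 μ ofPath measurable_comp_ofPath
  have hmem : ∀ t : ℝ≥0, ∀ᶠ J in (𝒰 : Filter (Finset ℝ≥0)), t ∈ J := fun t =>
    (Ultrafilter.of_le atTop) ((eventually_ge_atTop {t}).mono fun J hJ =>
      hJ (Finset.mem_singleton_self t))
  have hPb : ∀ (t : ℝ≥0) (f : ρ.calB), (∃ C : ℝ, ∀ x, |f x| ≤ C) →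
      ∃ C : ℝ, ∀ x, |P t f x| ≤ C := fun t f hf =>
    hf.imp fun C hC => ρ.abs_apply_le_of_abs_le (hP.positive t) (hone t) hC
  have hSb : ∀ f : C(StoneCech X, ℝ), ∃ C : ℝ, ∀ x, |ρ.ofStoneCech f x| ≤ C := fun f =>
    ⟨‖f‖, fun x => f.norm_coe_le_norm _⟩
  have hexp : ∀ (t : ℝ≥0) (f : ρ.calB), (∃ C : ℝ, ∀ x, |f x| ≤ C) → ∀ J : Finset ℝ≥0, t ∈ J →
      ∫ w, f (w t) ∂(μ J) = P t f x₀ := by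
    intro t f hf J hJ
    have h := hμm J 0 (Finset.mem_insert_self _ _) t (Finset.mem_insert_of_mem hJ) zero_le f hf
      (fun _ => 1) measurable_const ⟨1, fun _ => abs_one.le⟩ fun _ _ _ => rfl
    simp only [one_mul, tsub_zero] at h
    rw [h, hμ0 J _ (hPb t f hf)]
  have hmt : ∀ (t : ℝ≥0) (f : C(StoneCech X, ℝ)),
      ∫ z, f (eval t z) ∂m = (ρ.evalAt x₀).comp (P t) (ρ.ofStoneCech f) := by
    intro t f
    refine tendsto_nhds_unique (hm (f.comp (eval t))) (tendsto_const_nhds.congr' ?_)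
    filter_upwards [hmem t] with J hJ
    exact (hexp t _ (hSb f) J hJ).symm
  refine ⟨m, hmr, hmp, hmt, fun s t hst G hG f => ?_⟩
  set h : ρ.calB := P (t - s) (ρ.ofStoneCech f)
  have hhb : ∃ C : ℝ, ∀ x, |h x| ≤ C := hPb _ _ (hSb f)
  -- Convergence of the integrals extends from continuous functions to `h`, uniformly in `J`, since
  -- the first moments are controlled by the weighted norm.
  have hlim : Tendsto (fun J => ∫ w, G (ofPath w) * h (w s) ∂(μ J)) 𝒰
      (𝓝 (∫ z, G z * h (r (eval s z)) ∂m)) := by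
    set T := (ρ.evalAt x₀).comp (P s)
    obtain ⟨g, hg, hgb, hgh⟩ := ρ.exists_tendsto_boundedContinuous h
    have hzero : Tendsto (fun n => ‖G‖ * (‖T‖ * ‖h - g n‖)) atTop (𝓝 0) := by
      have := (tendsto_iff_norm_sub_tendsto_zero.1 hgh).const_mul (‖G‖ * ‖T‖)
      simpa only [mul_zero, mul_assoc, norm_sub_rev h] using this
    rw [Metric.tendsto_nhds]
    intro ε hε
    obtain ⟨n, hn⟩ := (hzero.eventually_lt_const (show 0 < ε / 3 by positivity)).exists
    obtain ⟨C, hC⟩ := hgb n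
    obtain ⟨g', hg'⟩ := ρ.exists_ofStoneCech_eq (g n) (hg n) hC
    obtain ⟨D, hD⟩ := hhb
    have hmea : ∀ k : ρ.calB, Measurable fun w : ℝ≥0 → X => k (w s) := fun k =>
      (ρ.measurable_apply k).comp (measurable_pi_apply s)
    have hmea' : ∀ k : ρ.calB, Measurable fun z : PathSpace X => k (r (eval s z)) := fun k =>
      (ρ.measurable_apply k).comp (hr.comp (eval s).continuous.measurable)
    have hintJ : ∀ (J : Finset ℝ≥0) (k : ρ.calB) (c : ℝ), (∀ x, |k x| ≤ c) →
        Integrable (fun w => G (ofPath w) * k (w s)) (μ J) := fun J k c hk =>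
      Integrable.of_bound ((measurable_comp_ofPath G).mul (hmea k)).aestronglyMeasurable
        (‖G‖ * c) (ae_of_all _ fun w => by
          rw [norm_mul]
          exact mul_le_mul (G.norm_coe_le_norm _) (hk _) (norm_nonneg _) (norm_nonneg _))
    have hintm : ∀ k : ρ.calB, Integrable (fun z => G z * k (r (eval s z))) m := fun k =>
      (ρ.integrable_retraction m (eval s).continuous T (hmt s) hr hru k).bdd_mul
        G.continuous.measurable.aestronglyMeasurable (ae_of_all _ fun z => G.norm_coe_le_norm z)
    have hbound : ∀ (J : Finset ℝ≥0), s ∈ J →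
        |∫ w, G (ofPath w) * h (w s) ∂(μ J) - ∫ w, G (ofPath w) * g n (w s) ∂(μ J)|
          ≤ ‖G‖ * (‖T‖ * ‖h - g n‖) := by
      intro J hJ
      obtain ⟨a, ha, han⟩ := ρ.exists_abs (h - g n)
      have hab : ∀ x, |a x| ≤ D + C := fun x => by
        rw [ha, abs_abs]
        exact (abs_sub (h x) (g n x)).trans (add_le_add (hD x) (hC x))
      have hai : Integrable (fun w : ℝ≥0 → X => a (w s)) (μ J) :=
        Integrable.of_bound (hmea a).aestronglyMeasurable (D + C) (ae_of_all _ fun w => hab _)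
      rw [← integral_sub (hintJ J h D hD) (hintJ J (g n) C hC)]
      calc _ ≤ ∫ w, ‖G‖ * a (w s) ∂(μ J) := by
            refine (Real.norm_eq_abs _).ge.trans (norm_integral_le_of_norm_le (hai.const_mul _)
              (ae_of_all _ fun w => ?_))
            rw [← mul_sub, norm_mul, ha]
            exact mul_le_mul_of_nonneg_right (G.norm_coe_le_norm _) (norm_nonneg _)
        _ ≤ ‖G‖ * (‖T‖ * ‖h - g n‖) := by
            rw [integral_const_mul, hexp s a ⟨_, hab⟩ J hJ, ← han]
            exact mul_le_mul_of_nonneg_left ((le_abs_self _).trans (T.le_opNorm a)) (norm_nonneg _)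
    have hboundm : |∫ z, G z * h (r (eval s z)) ∂m - ∫ z, G z * g n (r (eval s z)) ∂m|
          ≤ ‖G‖ * (‖T‖ * ‖h - g n‖) := by
      have hi := (ρ.integrable_retraction m (eval s).continuous T (hmt s) hr hru (h - g n)).norm
      rw [← integral_sub (hintm h) (hintm (g n))]
      calc _ ≤ ∫ z, ‖G‖ * |(h - g n) (r (eval s z))| ∂m := by
            refine (Real.norm_eq_abs _).ge.trans (norm_integral_le_of_norm_le (hi.const_mul _)
              (ae_of_all _ fun z => ?_))
            rw [← mul_sub, norm_mul]
            exact mul_le_mul_of_nonneg_right (G.norm_coe_le_norm _) (norm_nonneg _)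
        _ ≤ ‖G‖ * (‖T‖ * ‖h - g n‖) := by
            rw [integral_const_mul]
            exact mul_le_mul_of_nonneg_left (ρ.integral_abs_retraction_le m (eval s).continuous T
              (hmt s) hr hru _) (norm_nonneg _)
    have hlimg : Tendsto (fun J => ∫ w, G (ofPath w) * g n (w s) ∂(μ J)) 𝒰
        (𝓝 (∫ z, G z * g n (r (eval s z)) ∂m)) := by
      have hae := ρ.ae_apply_retraction_eq m (eval s).continuous T (hmt s) hru g'
      have heq : ∫ z, G z * g n (r (eval s z)) ∂m = ∫ z, (G * g'.comp (eval s)) z ∂m := by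
        refine integral_congr_ae (hae.mono fun z hz => ?_)
        dsimp only
        rw [← hg', hz]
        rfl
      rw [heq, ← hg']
      exact hm (G * g'.comp (eval s))
    filter_upwards [hmem s, Metric.tendsto_nhds.1 hlimg (ε / 3) (by positivity)] with J hJ hJg
    rw [Real.dist_eq] at hJg ⊢
    have h1 := abs_lt.1 hJg
    have h2 := abs_le.1 (hbound J hJ)
    have h3 := abs_le.1 hboundm
    exact abs_lt.2 ⟨by linarith, by linarith⟩
  refine tendsto_nhds_unique (hm (G * f.comp (eval t))) (hlim.congr' ?_)
  filter_upwards [hmem s, hmem t] with J hs ht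
  exact (hμm J s (Finset.mem_insert_of_mem hs) t (Finset.mem_insert_of_mem ht) hst _ (hSb f)
    (fun w => G (ofPath w)) (measurable_comp_ofPath G) ⟨‖G‖, fun w => G.norm_coe_le_norm _⟩
    fun w w' hww' => hG _ _ fun u hu => by rw [eval_ofPath, eval_ofPath, hww' u hu]).symm

end PathLaw

/-! ### The Markov property with respect to the natural filtration -/

/-- The passage from continuous functionals of the past to indicators of Borel cylinder sets, one
coordinate at a time. -/
theorem integral_prod_indicator_mul_eq_zero (m : Measure (PathSpace X)) [IsFiniteMeasure m]
    [m.Regular] {s : ℝ≥0} {Ψ : PathSpace X → ℝ} (hΨ : Measurable Ψ) {C : ℝ}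
    (hC : ∀ z, |Ψ z| ≤ C)
    (h0 : ∀ G : C(PathSpace X, ℝ), (∀ z z', (∀ u ≤ s, eval u z = eval u z') → G z = G z') →
      ∫ z, G z * Ψ z ∂m = 0)
    {B : ℝ≥0 → Set (StoneCech X)} (J : Finset ℝ≥0) (hJ : ∀ u ∈ J, u ≤ s)
    (hB : ∀ u ∈ J, MeasurableSet (B u)) (G : C(PathSpace X, ℝ))
    (hG : ∀ z z', (∀ u ≤ s, eval u z = eval u z') → G z = G z') :
    ∫ z, (∏ u ∈ J, (B u).indicator (fun _ => (1 : ℝ)) (eval u z)) * (G z * Ψ z) ∂m = 0 := by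
  induction J using Finset.induction_on generalizing G with
  | empty => simpa using h0 G hG
  | insert a J ha ih =>
    rw [Finset.forall_mem_insert] at hJ hB
    have hmeas : Measurable fun z : PathSpace X =>
        ∏ u ∈ J, (B u).indicator (fun _ => (1 : ℝ)) (eval u z) :=
      Finset.measurable_prod _ fun u hu =>
        (measurable_const.indicator (hB.2 u hu)).comp (eval u).continuous.measurable
    have hle : ∀ z : PathSpace X,
        |∏ u ∈ J, (B u).indicator (fun _ => (1 : ℝ)) (eval u z)| ≤ 1 := by
      intro z
      rw [Finset.abs_prod]
      refine Finset.prod_le_one (fun _ _ => abs_nonneg _) fun u _ => ?_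
      by_cases hu : eval u z ∈ B u <;> simp [hu]
    simp only [Finset.prod_insert ha, mul_assoc]
    refine setIntegral_preimage_eq_zero m (eval a).continuous (Ψ := fun z =>
      (∏ u ∈ J, (B u).indicator (fun _ => (1 : ℝ)) (eval u z)) * (G z * Ψ z))
      (hmeas.mul (G.continuous.measurable.mul hΨ)).aestronglyMeasurable
      (C := 1 * (‖G‖ * C)) (fun z => ?_) (fun g => ?_) hB.1
    · rw [abs_mul, abs_mul]
      exact mul_le_mul (hle z) (mul_le_mul (G.norm_coe_le_norm z) (hC z) (abs_nonneg _)
        (norm_nonneg _)) (mul_nonneg (abs_nonneg _) (abs_nonneg _)) zero_le_one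
    · have h := ih hJ.2 hB.2 (g.comp (eval a) * G) fun z z' hzz' => by
        change g (eval a z) * G z = g (eval a z') * G z'
        rw [hG z z' hzz', hzz' a hJ.1]
      rw [← h]
      refine integral_congr_ae (ae_of_all _ fun z => ?_)
      change g (eval a z) * _ = _ * (g (eval a z) * G z * Ψ z)
      ring

theorem naturalSigma_le [MeasurableSpace X] {r : StoneCech X → X} (hr : Measurable r) (s : ℝ≥0) :
    naturalSigma (fun t (z : PathSpace X) => r (eval t z)) s
      ≤ (inferInstance : MeasurableSpace (PathSpace X)) :=
  iSup_le fun u => (hr.comp (eval (u : ℝ≥0)).continuous.measurable).comap_le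

/-- If `Ψ` is orthogonal to the continuous functionals of the past up to time `s`, it is orthogonal
to all events of the natural filtration of `r (z t)` at time `s`. -/
theorem setIntegral_eq_zero_of_naturalSigma [MeasurableSpace X] {r : StoneCech X → X}
    (hr : Measurable r) (m : Measure (PathSpace X)) [IsFiniteMeasure m] [m.Regular] {s : ℝ≥0}
    {Ψ : PathSpace X → ℝ} (hΨ : Measurable Ψ) {C : ℝ}
    (hC : ∀ z, |Ψ z| ≤ C)
    (h0 : ∀ G : C(PathSpace X, ℝ), (∀ z z', (∀ u ≤ s, eval u z = eval u z') → G z = G z') →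
      ∫ z, G z * Ψ z ∂m = 0) {A : Set (PathSpace X)}
    (hA : MeasurableSet[naturalSigma (fun t (z : PathSpace X) => r (eval t z)) s] A) :
    ∫ z in A, Ψ z ∂m = 0 := by
  have hle := naturalSigma_le (X := X) hr s
  have hΨi : Integrable Ψ m := Integrable.of_bound hΨ.aestronglyMeasurable C (ae_of_all _ hC)
  let mY : ℝ≥0 → MeasurableSpace (PathSpace X) := fun u =>
    MeasurableSpace.comap (fun z => r (eval u z)) inferInstance
  have hgen : naturalSigma (fun t (z : PathSpace X) => r (eval t z)) s
      = MeasurableSpace.generateFrom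
        (piiUnionInter (fun u => {S | MeasurableSet[mY u] S}) (Set.Iic s)) := by
    exact (iSup_subtype' (f := fun u _ => mY u)).symm.trans
      (generateFrom_piiUnionInter_measurableSet mY (Set.Iic s)).symm
  have huniv : ∫ z, Ψ z ∂m = 0 := by simpa using h0 1 fun _ _ _ => rfl
  induction A, hA using MeasurableSpace.induction_on_inter hgen
    (isPiSystem_piiUnionInter _
      (fun u => @MeasurableSpace.isPiSystem_measurableSet _ (mY u)) _) with
  | empty => simp
  | basic A hA =>
    obtain ⟨J, hJ, A', hA', rfl⟩ := hA
    have hB : ∀ u ∈ J, ∃ B : Set X, MeasurableSet B ∧ (fun z => r (eval u z)) ⁻¹' B = A' u := hA'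
    choose! B hBm hBA using hB
    have h := integral_prod_indicator_mul_eq_zero m hΨ hC h0 (B := fun u => r ⁻¹' B u) J
      (fun u hu => hJ hu) (fun u hu => hr (hBm u hu)) 1 fun _ _ _ => rfl
    have hm : MeasurableSet (⋂ u ∈ J, A' u) := by
      refine Finset.measurableSet_biInter _ fun u hu => ?_
      rw [← hBA u hu]
      exact (hr.comp (eval u).continuous.measurable) (hBm u hu)
    rw [← integral_indicator hm, ← h]
    refine integral_congr_ae (ae_of_all _ fun z => ?_)
    dsimp only
    rw [ContinuousMap.one_apply, one_mul]
    by_cases hz : z ∈ ⋂ u ∈ J, A' u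
    · rw [Set.indicator_of_mem hz, Finset.prod_eq_one, one_mul]
      intro u hu
      have hzu := Set.mem_iInter₂.1 hz u hu
      rw [← hBA u hu] at hzu
      exact Set.indicator_of_mem (s := r ⁻¹' B u) hzu _
    · rw [Set.indicator_of_notMem hz]
      simp only [Set.mem_iInter, not_forall] at hz
      obtain ⟨u, hu, hzu⟩ := hz
      rw [← hBA u hu] at hzu
      rw [Finset.prod_eq_zero hu (Set.indicator_of_notMem (s := r ⁻¹' B u) hzu _), zero_mul]
  | compl A hA ih =>
    have h := integral_add_compl (hle _ hA) hΨi
    rwa [ih, huniv, zero_add] at h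
  | iUnion A hd hA ih =>
    rw [integral_iUnion (fun i => hle _ (hA i)) hd hΨi.integrableOn]
    simp [ih]

end AdmissibleWeight

theorem mainTheorem8 {X : Type u} [TopologicalSpace X] [T35Space X] [MeasurableSpace X]
    [BorelSpace X] (ρ : AdmissibleWeight X) (P : ℝ≥0 → ρ.calB →L[ℝ] ρ.calB)
    (hP : ρ.IsGeneralizedFeller P) (hone : ∀ t : ℝ≥0, P t ρ.one = ρ.one) (M ω : ℝ)
    (hρ : ∀ (t : ℝ≥0) (x : X),
      ρ.applyWeight (P t) x ≤ ENNReal.ofReal (M * Real.exp (ω * (t : ℝ)) * ρ x)) :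
    ∃ (Ω : Type u) (_ : MeasurableSpace Ω) (Y : ℝ≥0 → Ω → X) (ℙ : X → Measure Ω),
      (∀ t : ℝ≥0, Measurable (Y t)) ∧
      ∀ x₀ : X,
        IsProbabilityMeasure (ℙ x₀) ∧
        (∀ᵐ w ∂(ℙ x₀), Y 0 w = x₀) ∧
        (∀ (t : ℝ≥0) (f : ρ.calB),
          Integrable (fun w => f (Y t w)) (ℙ x₀) ∧ ∫ w, f (Y t w) ∂(ℙ x₀) = P t f x₀) ∧
        (∀ (s t : ℝ≥0) (f : ρ.calB), s ≤ t →
          (ℙ x₀)[fun w => f (Y t w) | naturalSigma Y s]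
            =ᵐ[ℙ x₀] fun w => P (t - s) f (Y s w)) := by
  -- If `X` is empty there is no starting point, and `Ω` must be empty for the maps `Y t` to exist.
  cases isEmpty_or_nonempty X
  · exact ⟨PEmpty, ⊤, fun _ w => w.elim, fun _ => 0, fun _ => measurable_from_top,
      fun x₀ => isEmptyElim x₀⟩
  obtain ⟨r, hr, hru⟩ := ρ.exists_measurable_retraction
  choose m hmr hmp hmt hmm using hP.exists_law hone hr hru
  have hY : ∀ t : ℝ≥0, Measurable fun z : PathSpace X => r (PathSpace.eval t z) := fun t =>
    hr.comp (PathSpace.eval t).continuous.measurable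
  refine ⟨PathSpace X, inferInstance, fun t z => r (PathSpace.eval t z), m, hY, fun x₀ =>
    ⟨hmp x₀, ?_, fun t f => ?_, fun s t f hst => ?_⟩⟩
  · -- The law at time `0` is regular and represents evaluation at `x₀`, hence lives on `{x₀}`.
    have h : m x₀ (PathSpace.eval 0 ⁻¹' {stoneCechUnit x₀}ᶜ) ≤ 0 := by
      refine measure_preimage_le_of_integral_le (m x₀) (PathSpace.eval 0).continuous
        isClosed_singleton.isOpen_compl fun f _ hf0 => ?_
      rw [hmt, ContinuousLinearMap.comp_apply, hP.zero, ContinuousLinearMap.id_apply,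
        AdmissibleWeight.evalAt_apply, AdmissibleWeight.ofStoneCech_apply, hf0 _ (by simp),
        ENNReal.ofReal_zero]
    have h' : ∀ᵐ z ∂(m x₀), z ∉ PathSpace.eval 0 ⁻¹' {stoneCechUnit x₀}ᶜ :=
      measure_eq_zero_iff_ae_notMem.1 (le_antisymm h bot_le)
    filter_upwards [h'] with z hz
    have hz' : PathSpace.eval 0 z = stoneCechUnit x₀ := not_not.1 hz
    rw [hz', hru]
  · exact ⟨ρ.integrable_retraction (m x₀) (PathSpace.eval t).continuous _ (hmt x₀ t) hr hru f,
      ρ.integral_retraction (m x₀) (PathSpace.eval t).continuous _ (hmt x₀ t) hr hru f⟩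
  · have hle := AdmissibleWeight.naturalSigma_le (X := X) hr s
    have hint := fun (u : ℝ≥0) =>
      ρ.integrable_retraction (m x₀) (PathSpace.eval u).continuous _ (hmt x₀ u) hr hru
    refine (ae_eq_condExp_of_forall_setIntegral_eq hle (hint t f)
      (fun A _ _ => (hint s _).integrableOn) (fun A hA _ => ?_) ?_).symm
    · have hcont := fun u : ℝ≥0 =>
        ρ.continuous_setIntegral_retraction (m x₀) (PathSpace.eval u).continuous _ (hmt x₀ u)
          hr hru A
      -- Both sides are continuous in `f`, so `f` may be taken bounded and continuous.
      refine ρ.isClosed_induction (p := fun f =>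
        ∫ z in A, P (t - s) f (r (PathSpace.eval s z)) ∂(m x₀)
          = ∫ z in A, f (r (PathSpace.eval t z)) ∂(m x₀))
        (isClosed_eq ((hcont s).comp (P (t - s)).continuous) (hcont t)) (fun g hg hgb => ?_) f
      obtain ⟨C, hC⟩ := hgb
      obtain ⟨g', rfl⟩ := ρ.exists_ofStoneCech_eq g hg hC
      set k := P (t - s) (ρ.ofStoneCech g')
      have hk : ∀ x, |k x| ≤ C := ρ.abs_apply_le_of_abs_le (hP.positive _) (hone _) hC
      have hae := ρ.ae_apply_retraction_eq (m x₀) (PathSpace.eval t).continuous _ (hmt x₀ t) hru g'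
      have h := AdmissibleWeight.setIntegral_eq_zero_of_naturalSigma hr (m x₀) (s := s)
        (Ψ := fun z => ρ.ofStoneCech g' (r (PathSpace.eval t z)) - k (r (PathSpace.eval s z)))
        (((ρ.measurable_apply _).comp (hY t)).sub ((ρ.measurable_apply k).comp (hY s)))
        (C := C + C) (fun z => (abs_sub _ _).trans (add_le_add (hC _) (hk _)))
        (fun G hG => ?_) hA
      · rw [integral_sub (hint t _).integrableOn (hint s k).integrableOn, sub_eq_zero] at h
        exact h.symm
      · have hGi : ∀ (u : ℝ≥0) (l : ρ.calB),
            Integrable (fun z => G z * l (r (PathSpace.eval u z))) (m x₀) := fun u l =>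
          (hint u l).bdd_mul G.continuous.measurable.aestronglyMeasurable
            (ae_of_all _ fun z => G.norm_coe_le_norm z)
        simp only [mul_sub]
        rw [integral_sub (hGi t _) (hGi s k), ← hmm x₀ s t hst G hG g', sub_eq_zero]
        exact integral_congr_ae (hae.mono fun z hz => by dsimp only; rw [hz])
    · refine Measurable.aestronglyMeasurable ((ρ.measurable_apply _).comp ?_)
      exact (comap_measurable _).mono
        (le_iSup (fun u : Set.Iic s =>
          MeasurableSpace.comap (fun z => r (PathSpace.eval (u : ℝ≥0) z)) inferInstance)
          ⟨s, Set.self_mem_Iic⟩) le_rfl
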